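/- **Setting.** Let $\mathcal X,\mathcal Y$ be measurable spaces (inputs and labels, e.g. $\mathcal Y=\{-1,+1\}$), let $\{a,b\}$ be the two values of a sensitive attribute, and let $\mathcal D$ be a probability distribution on $\mathcal X\times\{a,b\}\times\mathcal Y$ under which both groups have positive probability. Let $\mathcal D_{|g}$ be the conditional distribution of $(x,y)$ given the attribute $g$. Let $\ell:\mathcal Y'\times\mathcal Y\to\{0,1\}$ be a binary loss and let $\mathcal H$ be a set of classifiers $h:\mathcal X\to\mathcal Y'$, equipped with a $\sigma$-algebra for which $(h,x,y)\mapsto\ell(h(x),y)$ is measurable. For a distribution $P$ of $(x,y)$ (where $P=\mathcal D$ stands for the $(x,y)$-marginal of $\mathcal D$), a probability distribution $\rho$ on $\mathcal H$ and a classifier $h:\mathcal X\to\mathcal Y'$ for which $(x,y)\mapsto\ell(h(x),y)$ is measurable, put $$R_P(h)=\mathbb E_{(x,y)\sim P}\,\ell(h(x),y),\qquad R_P(G_\rho)=\mathbb E_{h'\sim\rho}R_P(h'),\qquad RF_{\mathcal D}(h)=|R_{\mathcal D_{|a}}(h)-R_{\mathcal D_{|b}}(h)|,$$ $$b_P^\rho(h)=\mathbb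 E_{P}\big[\mathbb E_{h'\sim\rho}\ell(h'(x),y)\,\big|\,\ell(h(x),y)=0\big],\qquad c_P^\rho(h)=\mathbb E_{P}\big[\mathbb E_{h'\sim\rho}\ell(h'(x),y)\,\big|\,\ell(h(x),y)=1\big].$$ For a sample $S\sim\mathcal D^m$, let $S_{|g}$ be the sub-sample of the examples with attribute $g$. For $T\in\{S,S_{|a},S_{|b}\}$ of size $m_T$, let $\widehat R_T(G_\rho)=\mathbb E_{h'\sim\rho}\frac1{m_T}\sum_{(x,y)\in T}\ell(h'(x),y)$, and for a prior $\pi$ on $\mathcal H$ and $\delta'\in(0,1]$ let $$R_T^{\uparrow}(\rho,\pi,\delta',G_\rho)=\max\{r\in[0,1]:\mathrm{kl}(\widehat R_T(G_\rho)\|r)\le\varepsilon\},\qquad R_T^{\downarrow}(\rho,\pi,\delta',G_\rho)=\min\{r\in[0,1]:\mathrm{kl}(\widehat R_T(G_\rho)\|r)\le\varepsilon\},$$ $$\varepsilon=\frac1{m_T}\Big[\mathrm{KL}(\rho\|\pi)+\ln\frac{2\sqrt{m_T}}{\delta'}\Big],\qquad \mathrm{kl}(q\|r)=q\ln\frac qr+(1-q)\ln\frac{1-q}{1-r},$$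 with $\varepsilon=\infty$ if $T$ is empty (so that then $R_T^\uparrow=1$ and $R_T^\downarrow=0$). Given numbers $b^\downarrow<c^\downarrow$ with $b^\downarrow\le b_P^\rho(h)$ and $c^\downarrow\le c_P^\rho(h)$, and numbers $b^\uparrow<c^\uparrow$ with $b_P^\rho(h)\le b^\uparrow$ and $c_P^\rho(h)\le c^\uparrow$ (where $P=\mathcal D,\mathcal D_{|a},\mathcal D_{|b}$ for $T=S,S_{|a},S_{|b}$ respectively, the numbers may depend on $P,\rho,h$, and an inequality on a conditional expectation is required only if the event conditioned on has positive probability), put $$\mathfrak R_T^{\uparrow}(\rho,\pi,\delta',h)=\frac{R_T^{\uparrow}(\rho,\pi,\delta',G_\rho)-b^\downarrow}{c^\downarrow-b^\downarrow},\qquad \mathfrak R_T^{\downarrow}(\rho,\pi,\delta',h)=\frac{R_T^{\downarrow}(\rho,\pi,\delta',G_\rho)-b^\uparrow}{c^\uparrow-b^\uparrow}.$$ **Theorem.** Let $\pi$ be a probability distribution on $\mathcal H$, $\delta\in(0,1]$, $\lambda\in[0,1]$ and $m\ge 0$. With probability at least $1-\delta$ over $S\sim\mathcal D^m$, for every probability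 distribution $\rho$ on $\mathcal H$, every classifier $h:\mathcal X\to\mathcal Y'$ for which $(x,y)\mapsto\ell(h(x),y)$ is measurable (in particular every $h\in\mathcal H$), and every choice of bounds $b^\downarrow,c^\downarrow$ for $\mathcal D,\mathcal D_{|a},\mathcal D_{|b}$ and $b^\uparrow,c^\uparrow$ for $\mathcal D_{|a},\mathcal D_{|b}$ as above, $$\begin{aligned}(1-\lambda)R_{\mathcal D}(h)+\lambda\,RF_{\mathcal D}(h)\ \le\ &(1-\lambda)\,\mathfrak R_S^{\uparrow}(\rho,\pi,\tfrac\delta2,h)\\&+\lambda\max\Big\{\mathfrak R_{S_{|a}}^{\uparrow}(\rho,\pi,\tfrac\delta8,h)-\mathfrak R_{S_{|b}}^{\downarrow}(\rho,\pi,\tfrac\delta8,h),\ \mathfrak R_{S_{|b}}^{\uparrow}(\rho,\pi,\tfrac\delta8,h)-\mathfrak R_{S_{|a}}^{\downarrow}(\rho,\pi,\tfrac\delta8,h)\Big\}.\end{aligned}$$ (When $\mathcal Y'=\mathbb R$ and $h$ is the majority vote $x\mapsto\mathbb E_{h'\sim\rho}h'(x)$, the right-hand side is the training objective $\mathbf H_S(\rho)$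 of the self-bounding algorithm for the deterministic majority vote.) -/

import Mathlib

open MeasureTheory ProbabilityTheory
open scoped ENNReal

namespace PACFair

noncomputable section

/-- The KL-divergence `kl(q ‖ r) = q ln (q / r) + (1 - q) ln ((1 - q) / (1 - r))` between two
Bernoulli distributions, for `q, r ∈ [0, 1]`, with the usual conventions `0 ln (0 / r) = 0` and
`q ln (q / 0) = ∞` for `q > 0`. The real expression is nonnegative on `[0, 1]`, so that
`ENNReal.ofReal` loses nothing there. -/
def binKL (q r : ℝ) : ℝ≥0∞ :=
  if (r = 0 ∧ q ≠ 0) ∨ (r = 1 ∧ q ≠ 1) then ⊤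
  else ENNReal.ofReal (q * Real.log (q / r) + (1 - q) * Real.log ((1 - q) / (1 - r)))

/-- The upper inverse of `kl`: the largest `r ∈ [0, 1]` with `kl(q ‖ r) ≤ ε`. -/
def klInvUp (q : ℝ) (ε : ℝ≥0∞) : ℝ :=
  sSup {r : ℝ | r ∈ Set.Icc (0 : ℝ) 1 ∧ binKL q r ≤ ε}

/-- The lower inverse of `kl`: the smallest `r ∈ [0, 1]` with `kl(q ‖ r) ≤ ε`. -/
def klInvLow (q : ℝ) (ε : ℝ≥0∞) : ℝ :=
  sInf {r : ℝ | r ∈ Set.Icc (0 : ℝ) 1 ∧ binKL q r ≤ ε}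

/-- The complexity term `(1 / m) (K + ln (2 √m / δ))`, where `K` is a KL-divergence. It is
infinite for an empty sample: no data, no information. (For `m ≥ 1` and `0 < δ ≤ 1` the logarithm
is nonnegative.) -/
def klRadius (m : ℕ) (K : ℝ≥0∞) (δ : ℝ) : ℝ≥0∞ :=
  if m = 0 then ⊤ else (K + ENNReal.ofReal (Real.log (2 * √(m : ℝ) / δ))) / (m : ℝ≥0∞)

variable {X Y Y' H : Type*} [MeasurableSpace X] [MeasurableSpace Y] [MeasurableSpace H]

/-- The marginal on (input, label) of a distribution `D` of triples
(input, sensitive attribute, label). -/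
def xyMarginal (D : Measure (X × Bool × Y)) : Measure (X × Y) :=
  D.map fun z => (z.1, z.2.2)

/-- The conditional distribution `D_{|g}` of (input, label) given that the attribute is `g`. -/
def groupCond (D : Measure (X × Bool × Y)) (g : Bool) : Measure (X × Y) :=
  xyMarginal (ProbabilityTheory.cond D {z | z.2.1 = g})

/-- The true risk of the classifier `h` on the distribution `P`. -/
def risk (l : Y' → Y → ℝ) (P : Measure (X × Y)) (h : X → Y') : ℝ :=
  ∫ z, l (h z.1) z.2 ∂P

/-- The true Gibbs risk of `ρ` on `P`; the hypotheses are `f t`, `t : H`. -/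
def gibbsRisk (l : Y' → Y → ℝ) (f : H → X → Y') (P : Measure (X × Y)) (ρ : Measure H) : ℝ :=
  ∫ t, risk l P (f t) ∂ρ

/-- The true fairness risk `|R_{D|a}(h) - R_{D|b}(h)|`, with `a = true` and `b = false`. -/
def fairRisk (l : Y' → Y → ℝ) (D : Measure (X × Bool × Y)) (h : X → Y') : ℝ :=
  |risk l (groupCond D true) h - risk l (groupCond D false) h|

/-- The indices of the examples of `S` in the group `g`, that is, the sub-sample `S_{|g}`. -/
def groupIdx {m : ℕ} (S : Fin m → X × Bool × Y) (g : Bool) : Finset (Fin m) :=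
  Finset.univ.filter fun i => (S i).2.1 = g

/-- The empirical risk of `h` on the sub-sample of `S` with indices in `I`. -/
def empRisk {m : ℕ} (l : Y' → Y → ℝ) (S : Fin m → X × Bool × Y) (I : Finset (Fin m))
    (h : X → Y') : ℝ :=
  (1 / (I.card : ℝ)) * ∑ i ∈ I, l (h (S i).1) (S i).2.2

/-- The empirical Gibbs risk of `ρ` on the sub-sample of `S` with indices in `I`. -/
def empGibbsRisk {m : ℕ} (l : Y' → Y → ℝ) (f : H → X → Y') (S : Fin m → X × Bool × Y)
    (I : Finset (Fin m)) (ρ : Measure H) : ℝ :=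
  ∫ t, empRisk l S I (f t) ∂ρ

/-- The upper PAC-Bayesian bound `R↑(ρ, π, δ, G_ρ)` on the Gibbs risk, computed on the sub-sample
of `S` with indices in `I`. -/
def gibbsUp {m : ℕ} (l : Y' → Y → ℝ) (f : H → X → Y') (S : Fin m → X × Bool × Y)
    (I : Finset (Fin m)) (ρ π : Measure H) (δ : ℝ) : ℝ :=
  klInvUp (empGibbsRisk l f S I ρ) (klRadius I.card (InformationTheory.klDiv ρ π) δ)

/-- The lower PAC-Bayesian bound `R↓(ρ, π, δ, G_ρ)` on the Gibbs risk. -/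
def gibbsLow {m : ℕ} (l : Y' → Y → ℝ) (f : H → X → Y') (S : Fin m → X × Bool × Y)
    (I : Finset (Fin m)) (ρ π : Measure H) (δ : ℝ) : ℝ :=
  klInvLow (empGibbsRisk l f S I ρ) (klRadius I.card (InformationTheory.klDiv ρ π) δ)

/-- The set of examples on which the classifier `h` has loss `v`. -/
def lossEvent (l : Y' → Y → ℝ) (h : X → Y') (v : ℝ) : Set (X × Y) :=
  {z | l (h z.1) z.2 = v}

/-- The conditional expectation `E_{(x,y) ~ P} [ E_{h' ~ ρ} l(h'(x), y) | l(h(x), y) = v ]`.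
It is `b_P^ρ(h)` for `v = 0` and `c_P^ρ(h)` for `v = 1`. -/
def condGibbs (l : Y' → Y → ℝ) (f : H → X → Y') (P : Measure (X × Y)) (ρ : Measure H)
    (h : X → Y') (v : ℝ) : ℝ :=
  ∫ z, (∫ t, l (f t z.1) z.2 ∂ρ) ∂(ProbabilityTheory.cond P (lossEvent l h v))

/-- A pair of numbers, meant to bound `b_P^ρ(h)` and `c_P^ρ(h)` on the same side. -/
structure CondBound where
  b : ℝ
  c : ℝ

/-- `β = (b↓, c↓)`: lower bounds on `b_P^ρ(h)` and `c_P^ρ(h)` with `b↓ < c↓`. A conditional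
expectation is only constrained if it exists, that is, if the event that it is conditioned on
has positive probability. -/
structure IsLowerCondBound (l : Y' → Y → ℝ) (f : H → X → Y') (P : Measure (X × Y))
    (ρ : Measure H) (h : X → Y') (β : CondBound) : Prop where
  b_le : P (lossEvent l h 0) ≠ 0 → β.b ≤ condGibbs l f P ρ h 0
  c_le : P (lossEvent l h 1) ≠ 0 → β.c ≤ condGibbs l f P ρ h 1
  b_lt_c : β.b < β.c

/-- `β = (b↑, c↑)`: upper bounds on `b_P^ρ(h)` and `c_P^ρ(h)` with `b↑ < c↑`. -/
structure IsUpperCondBound (l : Y' → Y → ℝ) (f : H → X → Y') (P : Measure (X × Y))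
    (ρ : Measure H) (h : X → Y') (β : CondBound) : Prop where
  le_b : P (lossEvent l h 0) ≠ 0 → condGibbs l f P ρ h 0 ≤ β.b
  le_c : P (lossEvent l h 1) ≠ 0 → condGibbs l f P ρ h 1 ≤ β.c
  b_lt_c : β.b < β.c

/-- The upper bound `ℜ↑(ρ, π, δ, h) = (R↑(ρ, π, δ, G_ρ) - b↓) / (c↓ - b↓)` on the risk of a
deterministic classifier `h`; it depends on `h` through `β = (b↓, c↓)`. -/
def detUp {m : ℕ} (l : Y' → Y → ℝ) (f : H → X → Y') (S : Fin m → X × Bool × Y)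
    (I : Finset (Fin m)) (ρ π : Measure H) (δ : ℝ) (β : CondBound) : ℝ :=
  (gibbsUp l f S I ρ π δ - β.b) / (β.c - β.b)

/-- The lower bound `ℜ↓(ρ, π, δ, h) = (R↓(ρ, π, δ, G_ρ) - b↑) / (c↑ - b↑)` on the risk of a
deterministic classifier `h`; it depends on `h` through `β = (b↑, c↑)`. -/
def detLow {m : ℕ} (l : Y' → Y → ℝ) (f : H → X → Y') (S : Fin m → X × Bool × Y)
    (I : Finset (Fin m)) (ρ π : Measure H) (δ : ℝ) (β : CondBound) : ℝ :=
  (gibbsLow l f S I ρ π δ - β.b) / (β.c - β.b)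

/-- The max-of-differences bound on the fairness risk at confidence `δ`. Here `loA`, `upA`
(`loB`, `upB`) are the bounds on the conditional expectations of the group `a` (`b`). -/
def fairBound {m : ℕ} (l : Y' → Y → ℝ) (f : H → X → Y') (S : Fin m → X × Bool × Y)
    (ρ π : Measure H) (δ : ℝ) (loA upA loB upB : CondBound) : ℝ :=
  max
    (detUp l f S (groupIdx S true) ρ π δ loA - detLow l f S (groupIdx S false) ρ π δ upB)
    (detUp l f S (groupIdx S false) ρ π δ loB - detLow l f S (groupIdx S true) ρ π δ upA)

/-- The objective of the self-bounding algorithm for a deterministic classifier: `ℜ↑` of the whole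
sample at confidence `δ / 2`, traded off against the fairness bound at confidence `δ / 8`. -/
def objectiveH {m : ℕ} (l : Y' → Y → ℝ) (f : H → X → Y') (S : Fin m → X × Bool × Y)
    (ρ π : Measure H) (δ lam : ℝ) (lo loA upA loB upB : CondBound) : ℝ :=
  (1 - lam) * detUp l f S Finset.univ ρ π (δ / 2) lo
    + lam * fairBound l f S ρ π (δ / 8) loA upA loB upB

end

end PACFair

namespace PACFair

/-! Two independent arguments are combined. The first is a PAC-Bayesian `kl` bound for the Gibbs
risk on the whole sample and on each group. For a fixed hypothesis with true error `r` and `k`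
errors among `n` points, `exp (n * kl(k/n ‖ r))` is the ratio of the maximal likelihood to the true
one. Divided by `maxLikSum n ≤ 2√n`, it has mean at most 1. This persists when the sub-sample is
random, because the normalisation may depend on its size (`lintegral_likRatio_le_one`). Fubini and
Markov's inequality give an event that involves only the prior. On it, change of measure bounds `kl`
for all posteriors `ρ` at once (`binKL_integral_le_klRadius`). The function `kl` may be infinite and
is not affine; both difficulties vanish on writing it as a supremum of functions `klAffine`, which
are bounded and commute with the mean under `ρ`.

The second is deterministic: splitting on whether `h` errs, `R(G_ρ) = (1 - R(h)) b + R(h) c`.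
Replacing `b` and `c` by bounds and solving for `R(h)` transfers any bound on the Gibbs risk to any
classifier `h` (`risk_le_of_isLowerCondBound`, `le_risk_of_isUpperCondBound`). A union bound over
three events concludes. -/

/-! ### Binomial sums: `maxLikSum n ≤ 2√n`. -/

/-- The maximal value `(k / n) ^ k * ((n - k) / n) ^ (n - k)` of `r ↦ r ^ k * (1 - r) ^ (n - k)`. -/
noncomputable def maxLik (n k : ℕ) : ℝ :=
  ((k : ℝ) / n) ^ k * (((n - k : ℕ) : ℝ) / n) ^ (n - k)

/-- The sum over `k` of the probabilities of the value `k` under the binomial distribution with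
parameters `n` and `k / n`. -/
noncomputable def maxLikSum (n : ℕ) : ℝ :=
  ∑ k ∈ Finset.range (n + 1), (n.choose k : ℝ) * maxLik n k

lemma maxLik_nonneg (n k : ℕ) : 0 ≤ maxLik n k := by
  unfold maxLik; positivity

lemma maxLik_zero_right (n : ℕ) : maxLik n 0 = 1 := by
  rcases Nat.eq_zero_or_pos n with rfl | hn
  · simp [maxLik]
  · have : (n : ℝ) ≠ 0 := by positivity
    simp [maxLik, this]

lemma maxLikSum_pos (n : ℕ) : 0 < maxLikSum n := by
  unfold maxLikSum
  refine Finset.sum_pos' (fun k _ => mul_nonneg (by positivity) (maxLik_nonneg n k))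
    ⟨0, by simp, ?_⟩
  simp [maxLik_zero_right]

/-- The normalised central binomial coefficient. -/
noncomputable def centralRatio (k : ℕ) : ℝ := (k.centralBinom : ℝ) / 4 ^ k

lemma centralRatio_pos (k : ℕ) : 0 < centralRatio k := by
  have := k.centralBinom_pos
  unfold centralRatio; positivity

lemma centralRatio_zero : centralRatio 0 = 1 := by simp [centralRatio]

lemma centralRatio_succ (k : ℕ) :
    ((k : ℝ) + 1) * centralRatio (k + 1) = (k + 1 / 2) * centralRatio k := by
  have h : ((k : ℝ) + 1) * (k + 1).centralBinom = 2 * (2 * k + 1) * k.centralBinom := by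
    exact_mod_cast Nat.succ_mul_centralBinom_succ k
  unfold centralRatio
  rw [pow_succ, ← mul_div_assoc, h]
  field_simp
  ring

/-- The terms are the Taylor coefficients of `(1 - x)^(-1/2)`, whose square is the geometric series.
The proof is elementary: by the symmetry `k ↔ n - k`, a weight `k` averages to `n / 2`, and
`centralRatio_succ` then shows that consecutive sums agree. -/
lemma sum_centralRatio_mul (n : ℕ) :
    ∑ k ∈ Finset.range (n + 1), centralRatio k * centralRatio (n - k) = 1 := by
  have half : ∀ n : ℕ, 2 * ∑ k ∈ Finset.range (n + 1), (k : ℝ) * (centralRatio k *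
      centralRatio (n - k)) =
      n * ∑ k ∈ Finset.range (n + 1), centralRatio k * centralRatio (n - k) := by
    intro n
    rw [two_mul]
    nth_rewrite 2 [← Finset.sum_range_reflect]
    rw [← Finset.sum_add_distrib, Finset.mul_sum]
    refine Finset.sum_congr rfl fun k hk => ?_
    have hk : k ≤ n := Nat.lt_succ_iff.mp (Finset.mem_range.mp hk)
    have h1 : n + 1 - 1 - k = n - k := by omega
    rw [h1, Nat.sub_sub_self hk, Nat.cast_sub hk]
    ring
  induction n with
  | zero => simp [centralRatio_zero]
  | succ n ih =>
    have h := half (n + 1)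
    rw [Finset.sum_range_succ'] at h
    have h2 : ∑ k ∈ Finset.range (n + 1), ((k + 1 : ℕ) : ℝ) * (centralRatio (k + 1) *
        centralRatio (n + 1 - (k + 1))) = ∑ k ∈ Finset.range (n + 1), ((k : ℝ) *
        (centralRatio k * centralRatio (n - k)) + 1 / 2 *
          (centralRatio k * centralRatio (n - k))) := by
      refine Finset.sum_congr rfl fun k _ => ?_
      rw [Nat.add_sub_add_right, Nat.cast_succ, ← mul_assoc, centralRatio_succ]
      ring
    rw [h2, Finset.sum_add_distrib, ← Finset.mul_sum, ih] at h
    have h3 := half n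
    rw [ih] at h3
    push_cast at h
    have hn : (n : ℝ) + 1 ≠ 0 := by positivity
    refine mul_left_cancel₀ hn ?_
    linarith

/-- The square `4 n * centralRatio n ^ 2` equals 1 at `n = 1` and increases with `n`. -/
lemma one_le_two_sqrt_mul_centralRatio (n : ℕ) (hn : 1 ≤ n) :
    1 ≤ 2 * √n * centralRatio n := by
  have key : (1 : ℝ) ≤ 4 * n * centralRatio n ^ 2 := by
    induction n, hn using Nat.le_induction with
    | base =>
      have := centralRatio_succ 0
      rw [centralRatio_zero] at this
      norm_num at this
      rw [this]; norm_num
    | succ n hn ih =>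
      have h := centralRatio_succ n
      have hp : (0 : ℝ) < n + 1 := by positivity
      have h' : centralRatio (n + 1) = (n + 1 / 2) / (n + 1) * centralRatio n := by
        field_simp at h ⊢; linarith
      rw [h', mul_pow, div_pow]
      push_cast
      have : 4 * ((n : ℝ) + 1) * ((n + 1 / 2) ^ 2 / (n + 1) ^ 2 * centralRatio n ^ 2) =
          4 * n * centralRatio n ^ 2 + centralRatio n ^ 2 / (n + 1) := by
        field_simp; ring
      rw [this]
      have : 0 ≤ centralRatio n ^ 2 / (n + 1) := by positivity
      linarith
  have h0 : 0 ≤ 2 * √n * centralRatio n := by have := centralRatio_pos n; positivity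
  rw [← one_le_sq_iff₀ h0, mul_pow, mul_pow, Real.sq_sqrt (by positivity)]
  linarith

/-- This is the logarithm of the comparison between the successive quotients of `stirlingRatio` and
`centralRatio`. -/
lemma mul_log_one_add_inv_add_log_le (k : ℕ) (hk : 1 ≤ k) :
    (k : ℝ) * Real.log ((k + 1) / k) + Real.log ((2 * k + 2) / (2 * k + 1)) ≤ 1 := by
  have hk' : (1 : ℝ) ≤ k := by exact_mod_cast hk
  -- In this variable `(k + 1) / k = (1 + x) / (1 - x)`, whose logarithm has a fast odd series.
  obtain ⟨x, hx⟩ : ∃ x : ℝ, x = 1 / (2 * k + 1) := ⟨_, rfl⟩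
  have hx0 : 0 < x := by rw [hx]; positivity
  have hx3 : x ≤ 1 / 3 := by
    rw [hx]; exact one_div_le_one_div_of_le (by norm_num) (by linarith)
  have hkx : (k : ℝ) = (1 - x) / (2 * x) := by rw [hx]; field_simp; ring
  have e1 : ((k : ℝ) + 1) / k = (1 + x) / (1 - x) := by rw [hx]; field_simp; ring
  have e2 : (2 * (k : ℝ) + 2) / (2 * k + 1) = 1 + x := by rw [hx]; field_simp; ring
  have b1 := Real.log_div_le_sum_range_add (x := x) hx0.le (by linarith) 2
  have b2 := (abs_le.mp (Real.abs_log_sub_add_sum_range_le (x := -x)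
    (by rw [abs_neg, abs_of_pos hx0]; linarith) 4)).2
  rw [abs_neg, abs_of_pos hx0] at b2
  simp only [Finset.sum_range_succ, Finset.sum_range_zero] at b1 b2
  norm_num at b1 b2
  rw [e1, e2, hkx]
  have p1 : 0 < 1 - x := by linarith
  have c1 : (1 - x) / (2 * x) * Real.log ((1 + x) / (1 - x)) ≤
      1 - x + x ^ 2 / 3 - x ^ 3 / 3 + x ^ 4 / (1 + x) := by
    have : (1 - x) / (2 * x) * Real.log ((1 + x) / (1 - x)) =
      (1 - x) / x * (1 / 2 * Real.log ((1 + x) / (1 - x))) := by field_simp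
    rw [this]
    refine (mul_le_mul_of_nonneg_left b1 (by positivity)).trans (le_of_eq ?_)
    have : 1 - x ^ 2 = (1 - x) * (1 + x) := by ring
    rw [this]
    field_simp
    ring
  have c2 : x ^ 4 / (1 + x) ≤ x ^ 4 := div_le_self (by positivity) (by linarith)
  have c3 : x ^ 5 / (1 - x) ≤ x ^ 4 / 2 := by
    rw [div_le_div_iff₀ p1 (by norm_num)]
    have : 0 < x ^ 4 := by positivity
    nlinarith
  have c4 : x ^ 4 ≤ x ^ 2 / 9 := by
    have : x ^ 2 ≤ 1 / 9 := by nlinarith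
    nlinarith [sq_nonneg x]
  -- The linear and cubic terms cancel, leaving at most `1 - x² / 6 + 5 x⁴ / 4`; now `x² ≤ 1 / 9`
  -- suffices.
  nlinarith [sq_nonneg x]

/-- The reciprocal of `k!` divided by the leading part `(k / e) ^ k` of Stirling's formula. -/
noncomputable def stirlingRatio (k : ℕ) : ℝ := (k : ℝ) ^ k / (k.factorial * Real.exp 1 ^ k)

lemma stirlingRatio_pos (k : ℕ) : 0 < stirlingRatio k := by
  rcases Nat.eq_zero_or_pos k with rfl | hk
  · simp [stirlingRatio]
  · have : (0 : ℝ) < k := by exact_mod_cast hk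
    unfold stirlingRatio; positivity

lemma stirlingRatio_zero : stirlingRatio 0 = 1 := by simp [stirlingRatio]

lemma stirlingRatio_succ (k : ℕ) (hk : 1 ≤ k) :
    stirlingRatio (k + 1) = stirlingRatio k * ((((k : ℝ) + 1) / k) ^ k / Real.exp 1) := by
  have : (0 : ℝ) < k := by exact_mod_cast hk
  unfold stirlingRatio
  rw [Nat.factorial_succ, div_pow]
  push_cast
  field_simp
  ring

/-- Equality holds at `k = 1`, and each further step multiplies the left side by no more than the
right. At `k = 0` the inequality fails. -/
lemma stirlingRatio_le (k : ℕ) (hk : 1 ≤ k) :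
    stirlingRatio k ≤ 2 / Real.exp 1 * centralRatio k := by
  induction k, hk using Nat.le_induction with
  | base =>
    have := centralRatio_succ 0
    rw [centralRatio_zero] at this
    norm_num at this
    rw [this]
    apply le_of_eq
    simp [stirlingRatio]
    field_simp
  | succ k hk ih =>
    have hk' : (0 : ℝ) < k := by exact_mod_cast hk
    have h := Real.exp_le_exp.mpr (mul_log_one_add_inv_add_log_le k hk)
    rw [Real.exp_add, Real.exp_log (by positivity), Real.exp_nat_mul,
      Real.exp_log (by positivity)] at h
    rw [stirlingRatio_succ k hk]
    have hc : centralRatio (k + 1) = (2 * k + 1) / (2 * k + 2) * centralRatio k := by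
      have h := centralRatio_succ k
      field_simp
      linarith
    have h2 : (((k : ℝ) + 1) / k) ^ k / Real.exp 1 ≤ (2 * k + 1) / (2 * k + 2) := by
      rw [div_le_div_iff₀ (by positivity) (by positivity)]
      rw [← mul_div_assoc, div_le_iff₀ (by positivity)] at h
      linarith
    rw [hc]
    calc _ ≤ (2 / Real.exp 1 * centralRatio k) * ((2 * k + 1) / (2 * k + 2)) :=
          mul_le_mul ih h2 (by positivity) (by have := centralRatio_pos k; positivity)
      _ = _ := by ring

/-- The Stirling sequence decreases from its first value `e / √2`. -/
lemma inv_stirlingRatio_le (n : ℕ) (hn : 1 ≤ n) :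
    (stirlingRatio n)⁻¹ ≤ Real.exp 1 * √n := by
  have hn' : (0 : ℝ) < n := by exact_mod_cast hn
  have h : Stirling.stirlingSeq n ≤ Stirling.stirlingSeq 1 := by
    have := Stirling.stirlingSeq'_antitone (Nat.zero_le (n - 1))
    simpa [Nat.sub_add_cancel hn] using this
  rw [Stirling.stirlingSeq_one] at h
  have e : (stirlingRatio n)⁻¹ = Stirling.stirlingSeq n * (√2 * √n) := by
    rw [← Real.sqrt_mul (by norm_num)]
    unfold stirlingRatio Stirling.stirlingSeq
    rw [div_pow]
    field_simp
  rw [e]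
  calc _ ≤ Real.exp 1 / √2 * (√2 * √n) := mul_le_mul_of_nonneg_right h (by positivity)
    _ = _ := by field_simp

lemma choose_mul_maxLik (n k : ℕ) (hn : 1 ≤ n) (hk : k ≤ n) :
    (n.choose k : ℝ) * maxLik n k =
      stirlingRatio k * stirlingRatio (n - k) * (stirlingRatio n)⁻¹ := by
  have hn' : (0 : ℝ) < n := by exact_mod_cast hn
  obtain ⟨j, rfl⟩ := Nat.exists_eq_add_of_le hk
  rw [Nat.cast_choose ℝ hk]
  unfold maxLik stirlingRatio
  rw [Nat.add_sub_cancel_left, div_pow, div_pow, pow_add (Real.exp 1), pow_add ((k + j : ℕ) : ℝ)]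
  field_simp

/-- Maurer's estimate of the exponential moment of `n * kl` between the empirical and the true
frequency. -/
lemma maxLikSum_le (n : ℕ) (hn : 1 ≤ n) : maxLikSum n ≤ 2 * √n := by
  have hs : 1 ≤ √(n : ℝ) := by
    rw [Real.one_le_sqrt]; exact_mod_cast hn
  have h2e : (2 : ℝ) ≤ Real.exp 1 := by linarith [Real.add_one_le_exp (1 : ℝ)]
  obtain ⟨p, rfl⟩ := Nat.exists_eq_add_of_le' hn
  have hsum := sum_centralRatio_mul (p + 1)
  rw [Finset.sum_range_succ, Finset.sum_range_succ'] at hsum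
  unfold maxLikSum
  -- The two end terms, each equal to 1, are split off because `stirlingRatio_le` is unavailable at
  -- 0.
  rw [Finset.sum_range_succ, Finset.sum_range_succ']
  have hlast : ((p + 1).choose (p + 1) : ℝ) * maxLik (p + 1) (p + 1) = 1 := by
    rw [choose_mul_maxLik _ _ hn le_rfl, Nat.sub_self, stirlingRatio_zero, mul_one,
      mul_inv_cancel₀ (stirlingRatio_pos _).ne']
  have hfirst : ((p + 1).choose 0 : ℝ) * maxLik (p + 1) 0 = 1 := by
    simp [maxLik_zero_right]
  rw [hlast, hfirst]
  simp only [Nat.sub_self, Nat.sub_zero, centralRatio_zero, mul_one, one_mul] at hsum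
  have hmid : ∑ k ∈ Finset.range p, ((p + 1).choose (k + 1) : ℝ) * maxLik (p + 1) (k + 1) ≤
      ∑ k ∈ Finset.range p, (4 / Real.exp 1 * √((p + 1 : ℕ) : ℝ)) *
        (centralRatio (k + 1) * centralRatio (p + 1 - (k + 1))) := by
    refine Finset.sum_le_sum fun k hk => ?_
    have hk := Finset.mem_range.mp hk
    rw [choose_mul_maxLik _ _ hn (by omega)]
    have h1 := stirlingRatio_le (k + 1) (by omega)
    have h2 := stirlingRatio_le (p + 1 - (k + 1)) (by omega)
    have h3 := inv_stirlingRatio_le (p + 1) hn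
    have q1 := stirlingRatio_pos (k + 1)
    have q2 := stirlingRatio_pos (p + 1 - (k + 1))
    have q3 := stirlingRatio_pos (p + 1)
    have q4 := centralRatio_pos (k + 1)
    have q5 := centralRatio_pos (p + 1 - (k + 1))
    calc _ ≤ (2 / Real.exp 1 * centralRatio (k + 1)) *
          (2 / Real.exp 1 * centralRatio (p + 1 - (k + 1))) *
          (Real.exp 1 * √((p + 1 : ℕ) : ℝ)) := by gcongr
      _ = _ := by field_simp; ring
  rw [← Finset.mul_sum] at hmid
  have hc := one_le_two_sqrt_mul_centralRatio (p + 1) hn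
  set s := √((p + 1 : ℕ) : ℝ)
  set A := ∑ k ∈ Finset.range p, centralRatio (k + 1) * centralRatio (p + 1 - (k + 1))
  -- The end terms of the convolution are `centralRatio (p + 1)`, and `2 s` times this is at least
  -- 1. The saving pays exactly for the two ends of `maxLikSum`.
  have hA : s * A ≤ s - 1 := by
    have : A = 1 - 2 * centralRatio (p + 1) := by linarith
    rw [this]; nlinarith
  have h4 : 4 / Real.exp 1 ≤ 2 := by
    rw [div_le_iff₀ (Real.exp_pos 1)]; linarith
  have hA0 : 0 ≤ A :=
    Finset.sum_nonneg fun k _ => (mul_pos (centralRatio_pos _) (centralRatio_pos _)).le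
  have h5 : 4 / Real.exp 1 * s * A ≤ 2 * (s - 1) := by
    rw [mul_assoc]
    exact mul_le_mul h4 hA (by positivity) (by norm_num)
  linarith

/-- This is `u ≤ exp (u - 1)` at `u = n x / k`, raised to the power `k`. -/
lemma pow_mul_exp_sub_le (n k : ℕ) (hn : 1 ≤ n) (x : ℝ) (hx : 0 ≤ x) :
    x ^ k * Real.exp (k - n * x) ≤ ((k : ℝ) / n) ^ k := by
  have hn' : (0 : ℝ) < n := by exact_mod_cast hn
  rcases Nat.eq_zero_or_pos k with rfl | hk
  · simp; positivity
  have hk' : (0 : ℝ) < k := by exact_mod_cast hk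
  have h : Real.exp (k - n * x) = Real.exp (1 - n * x / k) ^ k := by
    rw [← Real.exp_nat_mul]; congr 1; field_simp
  rw [h, ← mul_pow]
  refine pow_le_pow_left₀ (by positivity) ?_ k
  have h1 := Real.add_one_le_exp (n * x / k - 1)
  have h2 : Real.exp (1 - n * x / k) = (Real.exp (n * x / k - 1))⁻¹ := by
    rw [← Real.exp_neg]; congr 1; ring
  rw [h2, ← div_eq_mul_inv, div_le_iff₀ (Real.exp_pos _)]
  calc x = k / n * (n * x / k) := by field_simp
    _ ≤ _ := by gcongr; linarith

/-! ### Likelihood ratios on random sub-samples. -/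

/-- The ratio of the maximal likelihood of `k` successes among `n` trials to their likelihood under
the success probability `r`, divided by `maxLikSum n`. -/
noncomputable def likRatio (n k : ℕ) (r : ℝ≥0∞) : ℝ≥0∞ :=
  ENNReal.ofReal (maxLik n k) / (r ^ k * (1 - r) ^ (n - k)) / ENNReal.ofReal (maxLikSum n)

open Classical in
/-- The indices of the points of the sample `S` that lie in `A`. -/
noncomputable def hitIdx {Z : Type*} {m : ℕ} (A : Set Z) (S : Fin m → Z) : Finset (Fin m) :=
  Finset.univ.filter fun i => S i ∈ A

lemma mem_hitIdx {Z : Type*} {m : ℕ} {A : Set Z} {S : Fin m → Z} {i : Fin m} :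
    i ∈ hitIdx A S ↔ S i ∈ A := by
  simp [hitIdx]

lemma measurable_likRatio (n k : ℕ) : Measurable (likRatio n k) := by
  unfold likRatio
  refine Measurable.div_const (Measurable.const_div (Measurable.mul ?_ ?_) _) _
  · exact measurable_id.pow_const _
  · exact (measurable_const.sub measurable_id).pow_const _

lemma sum_powerset_maxLik {α : Type*} (I : Finset α) :
    ∑ J ∈ I.powerset, ENNReal.ofReal (maxLik I.card J.card) / ENNReal.ofReal (maxLikSum I.card)
      = 1 := by
  rw [Finset.sum_powerset_apply_card
    (fun k => ENNReal.ofReal (maxLik I.card k) / ENNReal.ofReal (maxLikSum I.card))]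
  have : ∀ k, (I.card.choose k) • (ENNReal.ofReal (maxLik I.card k) /
      ENNReal.ofReal (maxLikSum I.card)) =
      ENNReal.ofReal ((I.card.choose k : ℝ) * maxLik I.card k) *
        (ENNReal.ofReal (maxLikSum I.card))⁻¹ := by
    intro k
    rw [nsmul_eq_mul, ENNReal.ofReal_mul (by positivity), ENNReal.ofReal_natCast, div_eq_mul_inv,
      mul_assoc]
  simp_rw [this]
  rw [← Finset.sum_mul, ← ENNReal.ofReal_sum_of_nonneg
    (fun k _ => mul_nonneg (by positivity) (maxLik_nonneg _ _))]
  refine ENNReal.mul_inv_cancel ?_ ENNReal.ofReal_ne_top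
  exact (ENNReal.ofReal_pos.mpr (maxLikSum_pos _)).ne'

section

variable {Z H : Type*} [MeasurableSpace Z] [MeasurableSpace H]

/-- Given which indices fall in `A`, the number of hits of `C` is binomial with parameter `r`. The
likelihood cancels and the maximal likelihoods sum to `maxLikSum` of the sub-sample size, whatever
that size is. -/
lemma lintegral_likRatio_le_one (D : Measure Z) [IsProbabilityMeasure D] {A C : Set Z}
    (hA : MeasurableSet A) (hC : MeasurableSet C) (hDA : D A ≠ 0) (m : ℕ) :
    ∫⁻ S, likRatio (hitIdx A S).card (hitIdx (A ∩ C) S).card (cond D A C)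
      ∂(Measure.pi fun _ : Fin m => D) ≤ 1 := by
  classical
  have := cond_isProbabilityMeasure hDA
  set r := cond D A C with hr
  have hr1 : cond D A Cᶜ = 1 - r := prob_compl_eq_one_sub hC
  have hAC : D (A ∩ C) = D A * r := by rw [hr, ← cond_mul_eq_inter hA, mul_comm]
  have hAC' : D (A \ C) = D A * (1 - r) := by
    rw [← hr1, Set.sdiff_eq, ← cond_mul_eq_inter hA, mul_comm]
  have hAc : D Aᶜ = 1 - D A := prob_compl_eq_one_sub hA
  -- The samples with exactly the indices `I` in `A` and, among them, exactly `J` in `C`.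
  let cell : Finset (Fin m) → Finset (Fin m) → Fin m → Set Z := fun I J i =>
    if i ∈ I then (if i ∈ J then A ∩ C else A \ C) else Aᶜ
  have hcell : ∀ I J, MeasurableSet (Set.univ.pi (cell I J)) := by
    intro I J
    refine MeasurableSet.univ_pi fun i => ?_
    dsimp only [cell]
    split_ifs
    exacts [hA.inter hC, hA.diff hC, hA.compl]
  have hmeas : ∀ I, ∀ J ∈ I.powerset, (Measure.pi fun _ : Fin m => D) (Set.univ.pi (cell I J)) =
      D A ^ I.card * (1 - D A) ^ (m - I.card) *
        (r ^ J.card * (1 - r) ^ (I.card - J.card)) := by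
    intro I J hJ
    have hJ := Finset.mem_powerset.mp hJ
    rw [Measure.pi_pi, ← Finset.prod_mul_prod_compl I, ← Finset.prod_sdiff hJ]
    have e1 : ∏ i ∈ I \ J, D (cell I J i) = (D A * (1 - r)) ^ (I.card - J.card) := by
      rw [← Finset.card_sdiff_of_subset hJ]
      refine Finset.prod_eq_pow_card fun i hi => ?_
      rw [Finset.mem_sdiff] at hi
      simp [cell, hi.1, hi.2, hAC']
    have e2 : ∏ i ∈ J, D (cell I J i) = (D A * r) ^ J.card := by
      refine Finset.prod_eq_pow_card fun i hi => ?_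
      simp [cell, hJ hi, hi, hAC]
    have e3 : ∏ i ∈ Iᶜ, D (cell I J i) = (1 - D A) ^ (m - I.card) := by
      have : m - I.card = Iᶜ.card := by simp [Finset.card_compl]
      rw [this]
      refine Finset.prod_eq_pow_card fun i hi => ?_
      rw [Finset.mem_compl] at hi
      simp [cell, hi, hAc]
    rw [e1, e2, e3, mul_pow, mul_pow]
    have : D A ^ I.card = D A ^ (I.card - J.card) * D A ^ J.card := by
      rw [← pow_add, Nat.sub_add_cancel (Finset.card_le_card hJ)]
    rw [this]
    ring
  have hbound : ∀ S : Fin m → Z,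
      likRatio (hitIdx A S).card (hitIdx (A ∩ C) S).card r ≤
      ∑ I : Finset (Fin m), ∑ J ∈ I.powerset,
        (Set.univ.pi (cell I J)).indicator (fun _ => likRatio I.card J.card r) S := by
    intro S
    have hsub : hitIdx (A ∩ C) S ∈ (hitIdx A S).powerset := by
      rw [Finset.mem_powerset]
      intro i hi
      rw [mem_hitIdx] at hi ⊢
      exact hi.1
    have hmem : S ∈ Set.univ.pi (cell (hitIdx A S) (hitIdx (A ∩ C) S)) := by
      intro i _
      dsimp only [cell]
      simp only [mem_hitIdx]
      split_ifs with h1 h2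
      · exact h2
      · exact ⟨h1, fun h => h2 ⟨h1, h⟩⟩
      · exact h1
    calc _ = (Set.univ.pi (cell (hitIdx A S) (hitIdx (A ∩ C) S))).indicator
          (fun _ => likRatio (hitIdx A S).card (hitIdx (A ∩ C) S).card r) S := by
          rw [Set.indicator_of_mem hmem]
      _ ≤ ∑ J ∈ (hitIdx A S).powerset, (Set.univ.pi (cell (hitIdx A S) J)).indicator
          (fun _ => likRatio (hitIdx A S).card J.card r) S :=
          Finset.single_le_sum (f := fun J => (Set.univ.pi (cell (hitIdx A S) J)).indicator
            (fun _ => likRatio (hitIdx A S).card J.card r) S) (fun _ _ => zero_le) hsub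
      _ ≤ _ := Finset.single_le_sum (f := fun I => ∑ J ∈ I.powerset,
          (Set.univ.pi (cell I J)).indicator (fun _ => likRatio I.card J.card r) S)
          (fun _ _ => zero_le) (Finset.mem_univ _)
  calc _ ≤ ∫⁻ S, ∑ I : Finset (Fin m), ∑ J ∈ I.powerset,
        (Set.univ.pi (cell I J)).indicator (fun _ => likRatio I.card J.card r) S
          ∂(Measure.pi fun _ : Fin m => D) := lintegral_mono hbound
    _ = ∑ I : Finset (Fin m), ∑ J ∈ I.powerset,
        likRatio I.card J.card r *
          (Measure.pi fun _ : Fin m => D) (Set.univ.pi (cell I J)) := by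
        rw [lintegral_finsetSum _ (fun I _ => Finset.measurable_fun_sum _ fun J _ =>
          measurable_const.indicator (hcell I J))]
        refine Finset.sum_congr rfl fun I _ => ?_
        rw [lintegral_finsetSum _ (fun J _ => measurable_const.indicator (hcell I J))]
        refine Finset.sum_congr rfl fun J _ => ?_
        rw [lintegral_indicator_const (hcell I J)]
    _ ≤ ∑ I : Finset (Fin m), D A ^ I.card * (1 - D A) ^ (m - I.card) * ∑ J ∈ I.powerset,
        ENNReal.ofReal (maxLik I.card J.card) / ENNReal.ofReal (maxLikSum I.card) := by
        refine Finset.sum_le_sum fun I _ => ?_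
        rw [Finset.mul_sum]
        refine Finset.sum_le_sum fun J hJ => ?_
        rw [hmeas I J hJ, mul_left_comm]
        gcongr
        rw [likRatio, div_eq_mul_inv _ (ENNReal.ofReal (maxLikSum I.card)), mul_right_comm,
          div_eq_mul_inv _ (ENNReal.ofReal (maxLikSum I.card)), mul_comm (_ / _)]
        gcongr
        -- Only an inequality: for `r = 0` or `r = 1` the likelihood can vanish.
        exact ENNReal.mul_div_le
    _ = 1 := by
        simp_rw [sum_powerset_maxLik, mul_one]
        have h := Fintype.sum_pow_mul_eq_add_pow (Fin m) (D A) (1 - D A)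
        rw [Fintype.card_fin] at h
        rw [h, add_tsub_cancel_of_le prob_le_one, one_pow]

/-- The likelihood ratio of the hypothesis `t`, whose errors are the points `z` with `(t, z) ∈ B`,
on the part of the sample that lies in `A`. -/
noncomputable def sampleRatio {m : ℕ} (D : Measure Z) (A : Set Z) (B : Set (H × Z))
    (p : H × (Fin m → Z)) : ℝ≥0∞ :=
  likRatio (hitIdx A p.2).card (hitIdx (A ∩ Prod.mk p.1 ⁻¹' B) p.2).card
    (cond D A (Prod.mk p.1 ⁻¹' B))

lemma measurable_card_hitIdx {m : ℕ} {A : Set Z} (hA : MeasurableSet A) {B : Set (H × Z)}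
    (hB : MeasurableSet B) :
    Measurable fun p : H × (Fin m → Z) => (hitIdx (A ∩ Prod.mk p.1 ⁻¹' B) p.2).card := by
  classical
  simp only [hitIdx, Finset.card_filter]
  refine Finset.measurable_fun_sum _ fun i _ => Measurable.ite ?_ measurable_const measurable_const
  have e1 : Measurable fun p : H × (Fin m → Z) => p.2 i :=
    (measurable_pi_apply i).comp measurable_snd
  exact (e1 hA).inter ((measurable_fst.prodMk e1) hB)

lemma measurable_sampleRatio {m : ℕ} (D : Measure Z) [IsProbabilityMeasure D] {A : Set Z}
    (hA : MeasurableSet A) {B : Set (H × Z)} (hB : MeasurableSet B) :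
    Measurable (sampleRatio (m := m) D A B) := by
  classical
  have h1 : Measurable fun q : ℝ≥0∞ × (ℕ × ℕ) => likRatio q.2.1 q.2.2 q.1 :=
    measurable_from_prod_countable_left fun q => measurable_likRatio q.1 q.2
  have h2 : Measurable fun p : H × (Fin m → Z) => (hitIdx A p.2).card := by
    simp only [hitIdx, Finset.card_filter]
    refine Finset.measurable_fun_sum _ fun i _ => Measurable.ite ?_ measurable_const measurable_const
    exact ((measurable_pi_apply i).comp measurable_snd) hA
  have h3 := measurable_card_hitIdx (m := m) hA hB
  have h4 : Measurable fun p : H × (Fin m → Z) => cond D A (Prod.mk p.1 ⁻¹' B) :=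
    (measurable_measure_prodMk_left hB).comp measurable_fst
  have h5 := h4.prodMk (h2.prodMk h3)
  have h6 := Measurable.comp h1 h5
  unfold sampleRatio
  simpa only [Function.comp_def] using h6

/-- With high probability, the mean likelihood ratio under the prior is small. -/
lemma measure_lintegral_sampleRatio_ge_le {m : ℕ} (D : Measure Z) [IsProbabilityMeasure D]
    {A : Set Z} (hA : MeasurableSet A) (hDA : D A ≠ 0) {B : Set (H × Z)} (hB : MeasurableSet B)
    (π : Measure H) [IsProbabilityMeasure π] (δ : ℝ) (hδ : 0 < δ) :
    (Measure.pi fun _ : Fin m => D)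
      {S | (ENNReal.ofReal δ)⁻¹ ≤ ∫⁻ t, sampleRatio D A B (t, S) ∂π} ≤ ENNReal.ofReal δ := by
  have hm := measurable_sampleRatio (m := m) D hA hB
  have h := mul_meas_ge_le_lintegral (μ := Measure.pi fun _ : Fin m => D)
    (f := fun S => ∫⁻ t, sampleRatio D A B (t, S) ∂π)
    hm.lintegral_prod_left' (ENNReal.ofReal δ)⁻¹
  have h1 : ∫⁻ S, ∫⁻ t, sampleRatio D A B (t, S) ∂π ∂(Measure.pi fun _ : Fin m => D) ≤ 1 := by
    rw [lintegral_lintegral_swap (f := fun S t => sampleRatio D A B (t, S))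
      (hm.comp measurable_swap).aemeasurable]
    calc _ ≤ ∫⁻ _ : H, 1 ∂π := lintegral_mono fun t =>
          lintegral_likRatio_le_one D hA (measurable_prodMk_left hB) hDA m
      _ = 1 := by simp
  have h2 := h.trans h1
  rw [mul_comm, ← div_eq_mul_inv, ENNReal.div_le_iff (ENNReal.ofReal_pos.mpr hδ).ne'
    ENNReal.ofReal_ne_top, one_mul] at h2
  exact h2

end

/-! ### Change of measure and the PAC-Bayesian `kl` bound. -/

/-- The easy half of the Donsker-Varadhan variational formula, for bounded functions. -/
lemma integral_le_toReal_klDiv_add_log {H : Type*} [MeasurableSpace H] (ρ π : Measure H)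
    [IsProbabilityMeasure ρ] [IsProbabilityMeasure π]
    (hkl : InformationTheory.klDiv ρ π ≠ ⊤) {φ : H → ℝ} (hφ : Measurable φ) {c : ℝ}
    (hc : ∀ t, |φ t| ≤ c) :
    ∫ t, φ t ∂ρ ≤ (InformationTheory.klDiv ρ π).toReal +
      Real.log (∫ t, Real.exp (φ t) ∂π) := by
  obtain ⟨hac, hint⟩ := InformationTheory.klDiv_ne_top_iff.mp hkl
  have hφρ : Integrable φ ρ := .of_bound hφ.aestronglyMeasurable c (ae_of_all _ hc)
  have hexp : Integrable (fun t => Real.exp (φ t)) π := by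
    refine .of_bound hφ.exp.aestronglyMeasurable (Real.exp c) (ae_of_all _ fun t => ?_)
    rw [Real.norm_eq_abs, Real.abs_exp, Real.exp_le_exp]
    exact (le_abs_self _).trans (hc t)
  have hP : IsProbabilityMeasure (π.tilted φ) := isProbabilityMeasure_tilted hexp
  have hac' : ρ ≪ π.tilted φ := hac.trans (absolutelyContinuous_tilted hexp)
  have h := InformationTheory.toReal_klDiv_of_measure_eq hac' (by simp)
  have h' := InformationTheory.toReal_klDiv_of_measure_eq hac (by simp)
  rw [integral_llr_tilted_right hac hφρ hexp hint, ← h'] at h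
  have := ENNReal.toReal_nonneg (a := InformationTheory.klDiv ρ (π.tilted φ))
  linarith

/-- The lower bounds on `kl(q ‖ r)` that are affine in `q` and in `r`. -/
noncomputable def klAffine (a b q r : ℝ) : ℝ :=
  q * Real.log a + (1 - q) * Real.log b + 1 - r * a - (1 - r) * b

/-- The supremum over `a, b` is attained at `a = q / r`, `b = (1 - q) / (1 - r)` in the interior. On
the boundary it is only approached, or is infinite. -/
lemma binKL_le_of_klAffine_le {q r ε : ℝ} (hq : q ∈ Set.Icc (0 : ℝ) 1) (hr : r ∈ Set.Icc (0 : ℝ) 1)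
    (h : ∀ a b : ℝ, 0 < a → 0 < b → klAffine a b q r ≤ ε) :
    binKL q r ≤ ENNReal.ofReal ε := by
  unfold klAffine at h
  obtain ⟨hq0, hq1⟩ := hq
  obtain ⟨hr0, hr1⟩ := hr
  have hq0' : r = 0 → q = 0 := by
    rintro rfl
    by_contra hq
    -- With `r = 0` a large `a` costs nothing; this one gives the value `ε + 1`.
    have := h (Real.exp ((ε + 1) / q)) 1 (Real.exp_pos _) one_pos
    rw [Real.log_exp, mul_div_cancel₀ _ hq, Real.log_one] at this
    linarith
  have hq1' : r = 1 → q = 1 := by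
    rintro rfl
    by_contra hq
    have hq : 1 - q ≠ 0 := fun h => hq (by linarith)
    have := h 1 (Real.exp ((ε + 1) / (1 - q))) one_pos (Real.exp_pos _)
    rw [Real.log_exp, mul_div_cancel₀ _ hq, Real.log_one] at this
    linarith
  unfold binKL
  rw [if_neg (by rintro (⟨h1, h2⟩ | ⟨h1, h2⟩); exacts [h2 (hq0' h1), h2 (hq1' h1)])]
  have hε : 0 ≤ ε := by
    have := h 1 1 one_pos one_pos
    simp only [Real.log_one] at this
    linarith
  refine ENNReal.ofReal_le_ofReal ?_
  rcases hr0.eq_or_lt with rfl | hr0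
  · simp [hq0' rfl, hε]
  rcases hr1.eq_or_lt with rfl | hr1
  · simp [hq1' rfl, hε]
  have hr1' : 0 < 1 - r := by linarith
  rcases hq0.eq_or_lt with rfl | hq0
  -- The optimal `a` would be 0, so `η / r` is used, at a loss of `η`.
  · refine le_of_forall_pos_le_add fun η hη => ?_
    have := h (η / r) (1 / (1 - r)) (by positivity) (by positivity)
    rw [mul_div_cancel₀ _ hr0.ne', mul_one_div_cancel hr1'.ne'] at this
    simp only [sub_zero] at this ⊢
    linarith
  rcases hq1.eq_or_lt with rfl | hq1
  · refine le_of_forall_pos_le_add fun η hη => ?_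
    have := h (1 / r) (η / (1 - r)) (by positivity) (by positivity)
    rw [mul_div_cancel₀ _ hr1'.ne', mul_one_div_cancel hr0.ne'] at this
    simp only [sub_self, zero_mul] at this ⊢
    linarith
  have hq1' : 0 < 1 - q := by linarith
  have := h (q / r) ((1 - q) / (1 - r)) (by positivity) (by positivity)
  rw [mul_div_cancel₀ _ hr0.ne', mul_div_cancel₀ _ hr1'.ne'] at this
  linarith

lemma maxLik_pos {n k : ℕ} (hk : k ≤ n) : 0 < maxLik n k := by
  have : ∀ j : ℕ, j ≤ n → 0 < ((j : ℝ) / n) ^ j := by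
    intro j hj
    rcases Nat.eq_zero_or_pos j with rfl | hj0
    · simp
    · have : 0 < n := hj0.trans_le hj
      positivity
  exact mul_pos (this k hk) (this _ (Nat.sub_le n k))

/-- Multiplied by the likelihood, the exponential splits into two instances of `pow_mul_exp_sub_le`,
at `r a` and `(1 - r) b`. No division by `r` or `1 - r` occurs. -/
lemma ofReal_exp_klAffine_le {n k : ℕ} (hn : 1 ≤ n) (hk : k ≤ n) {r : ℝ}
    (hr : r ∈ Set.Icc (0 : ℝ) 1) {a b : ℝ} (ha : 0 < a) (hb : 0 < b) :
    ENNReal.ofReal (Real.exp (n * klAffine a b (k / n) r)) ≤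
      ENNReal.ofReal (maxLik n k) / (ENNReal.ofReal r ^ k * (1 - ENNReal.ofReal r) ^ (n - k)) := by
  obtain ⟨hr0, hr1⟩ := hr
  have hn' : (0 : ℝ) < n := by exact_mod_cast hn
  have hr1' : 0 ≤ 1 - r := by linarith
  rw [ENNReal.le_div_iff_mul_le (Or.inr (ENNReal.ofReal_pos.mpr (maxLik_pos hk)).ne')
    (Or.inr ENNReal.ofReal_ne_top), ← ENNReal.ofReal_one, ← ENNReal.ofReal_sub _ hr0,
    ← ENNReal.ofReal_pow hr0, ← ENNReal.ofReal_pow hr1', ← ENNReal.ofReal_mul (by positivity),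
    ← ENNReal.ofReal_mul (by positivity)]
  refine ENNReal.ofReal_le_ofReal ?_
  have h1 := pow_mul_exp_sub_le n k hn (r * a) (by positivity)
  have h2 := pow_mul_exp_sub_le n (n - k) hn ((1 - r) * b) (by positivity)
  have e : Real.exp (n * klAffine a b (k / n) r) =
      a ^ k * b ^ (n - k) * (Real.exp (k - n * (r * a)) *
        Real.exp ((n - k : ℕ) - n * ((1 - r) * b))) := by
    have ea : a ^ k = Real.exp (k * Real.log a) := by rw [Real.exp_nat_mul, Real.exp_log ha]
    have eb : b ^ (n - k) = Real.exp ((n - k : ℕ) * Real.log b) := by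
      rw [Real.exp_nat_mul, Real.exp_log hb]
    rw [ea, eb, ← Real.exp_add, ← Real.exp_add, ← Real.exp_add]
    congr 1
    unfold klAffine
    rw [Nat.cast_sub hk]
    field_simp
    ring
  rw [e]
  calc _ = ((r * a) ^ k * Real.exp (k - n * (r * a))) *
        (((1 - r) * b) ^ (n - k) * Real.exp ((n - k : ℕ) - n * ((1 - r) * b))) := by
        rw [mul_pow, mul_pow]; ring
    _ ≤ _ := mul_le_mul h1 h2 (by positivity) (by positivity)

/-- The PAC-Bayesian `kl` bound, on each sample for which the mean likelihood ratio under the prior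
is small. -/
lemma binKL_integral_le_klRadius {Z H : Type*} [MeasurableSpace Z] [MeasurableSpace H] {m : ℕ}
    (D : Measure Z) [IsProbabilityMeasure D] {A : Set Z} (hA : MeasurableSet A) (hDA : D A ≠ 0)
    {B : Set (H × Z)} (hB : MeasurableSet B) (π : Measure H) [IsProbabilityMeasure π]
    {δ : ℝ} (hδ0 : 0 < δ) (hδ1 : δ ≤ 1) (S : Fin m → Z)
    (hS : ∫⁻ t, sampleRatio D A B (t, S) ∂π ≤ (ENNReal.ofReal δ)⁻¹)
    (ρ : Measure H) [IsProbabilityMeasure ρ] :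
    binKL (∫ t, ((hitIdx (A ∩ Prod.mk t ⁻¹' B) S).card : ℝ) / (hitIdx A S).card ∂ρ)
      (∫ t, (cond D A).real (Prod.mk t ⁻¹' B) ∂ρ) ≤
      klRadius (hitIdx A S).card (InformationTheory.klDiv ρ π) δ := by
  have := cond_isProbabilityMeasure hDA
  unfold klRadius
  split_ifs with hn0
  · exact le_top
  set n := (hitIdx A S).card with hn_def
  have hn : 1 ≤ n := Nat.one_le_iff_ne_zero.mpr hn0
  have hn' : (0 : ℝ) < n := by exact_mod_cast hn
  by_cases hkl : InformationTheory.klDiv ρ π = ⊤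
  · rw [hkl, top_add, ENNReal.top_div_of_ne_top (ENNReal.natCast_ne_top n)]
    exact le_top
  set q : H → ℝ := fun t => ((hitIdx (A ∩ Prod.mk t ⁻¹' B) S).card : ℝ) / n with hq_def
  set r : H → ℝ := fun t => (cond D A).real (Prod.mk t ⁻¹' B) with hr_def
  have hk : ∀ t, (hitIdx (A ∩ Prod.mk t ⁻¹' B) S).card ≤ n := fun t =>
    Finset.card_le_card fun i hi => by rw [mem_hitIdx] at hi ⊢; exact hi.1
  have hq01 : ∀ t, q t ∈ Set.Icc (0 : ℝ) 1 := fun t =>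
    ⟨by positivity, div_le_one_of_le₀ (by exact_mod_cast hk t) hn'.le⟩
  have hr01 : ∀ t, r t ∈ Set.Icc (0 : ℝ) 1 := fun t => ⟨measureReal_nonneg, measureReal_le_one⟩
  have hqm : Measurable q := by
    have h1 := (measurable_card_hitIdx (m := m) hA hB).comp (measurable_prodMk_right (y := S))
    exact ((measurable_of_countable fun k : ℕ => (k : ℝ)).comp h1).div_const _
  have hrm : Measurable r := (measurable_measure_prodMk_left hB).ennreal_toReal
  have hint : ∀ {g : H → ℝ}, Measurable g → (∀ t, g t ∈ Set.Icc (0 : ℝ) 1) → Integrable g ρ := by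
    intro g hg h01
    refine .of_bound hg.aestronglyMeasurable 1 (ae_of_all _ fun t => ?_)
    rw [Real.norm_eq_abs, abs_of_nonneg (h01 t).1]
    exact (h01 t).2
  have hmean : ∀ {g : H → ℝ}, Measurable g → (∀ t, g t ∈ Set.Icc (0 : ℝ) 1) →
      ∫ t, g t ∂ρ ∈ Set.Icc (0 : ℝ) 1 := by
    intro g hg h01
    refine ⟨integral_nonneg fun t => (h01 t).1, ?_⟩
    calc _ ≤ ∫ _ : H, (1 : ℝ) ∂ρ :=
          integral_mono (hint hg h01) (integrable_const _) fun t => (h01 t).2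
      _ = 1 := by simp
  have hs : 1 ≤ √(n : ℝ) := by
    rw [Real.one_le_sqrt]; exact_mod_cast hn
  have hlog : 0 ≤ Real.log (2 * √n / δ) := by
    refine Real.log_nonneg ?_
    rw [le_div_iff₀ hδ0]
    linarith
  have hε : (InformationTheory.klDiv ρ π + ENNReal.ofReal (Real.log (2 * √n / δ))) / (n : ℝ≥0∞) =
      ENNReal.ofReal (((InformationTheory.klDiv ρ π).toReal + Real.log (2 * √n / δ)) / n) := by
    rw [ENNReal.ofReal_div_of_pos hn', ENNReal.ofReal_natCast,
      ENNReal.ofReal_add ENNReal.toReal_nonneg hlog, ENNReal.ofReal_toReal hkl]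
  rw [hε]
  -- With `a, b` fixed, the integrand is bounded, as the change of measure requires, and affine in
  -- `(q, r)`, so no convexity inequality is needed.
  refine binKL_le_of_klAffine_le (hmean hqm hq01) (hmean hrm hr01) fun a b ha hb => ?_
  set φ : H → ℝ := fun t => n * klAffine a b (q t) (r t) with hφ_def
  have hφm : Measurable φ := by
    unfold φ klAffine
    fun_prop
  have hφb : ∀ t, |φ t| ≤ n * (|Real.log a| + |Real.log b| + 1 + a + b) := by
    intro t
    obtain ⟨q0, q1⟩ := hq01 t
    obtain ⟨r0, r1⟩ := hr01 t
    have key : ∀ x y : ℝ, 0 ≤ x → x ≤ 1 → |x * y| ≤ |y| := fun x y h0 h1 => by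
      rw [abs_mul, abs_of_nonneg h0]; exact mul_le_of_le_one_left (abs_nonneg y) h1
    have k1 := abs_le.mp (key (q t) (Real.log a) q0 q1)
    have k2 := abs_le.mp (key (1 - q t) (Real.log b) (by linarith) (by linarith))
    have k3 := abs_le.mp (key (r t) a r0 r1)
    have k4 := abs_le.mp (key (1 - r t) b (by linarith) (by linarith))
    rw [abs_of_pos ha] at k3
    rw [abs_of_pos hb] at k4
    rw [hφ_def]
    dsimp only
    rw [abs_mul, abs_of_pos hn']
    refine mul_le_mul_of_nonneg_left ?_ hn'.le
    unfold klAffine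
    rw [abs_le]
    constructor <;> linarith [k1.1, k1.2, k2.1, k2.2, k3.1, k3.2, k4.1, k4.2]
  have hdv := integral_le_toReal_klDiv_add_log ρ π hkl hφm hφb
  have hφint : ∫ t, φ t ∂ρ = n * klAffine a b (∫ t, q t ∂ρ) (∫ t, r t ∂ρ) := by
    have hqi := hint hqm hq01
    have hri := hint hrm hr01
    have e : φ = fun t => (n * (Real.log a - Real.log b)) * q t + (n * (b - a)) * r t +
        n * (Real.log b + 1 - b) := by
      funext t
      simp only [hφ_def, klAffine]
      ring
    have hsum : Integrable (fun t => (n * (Real.log a - Real.log b)) * q t +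
        (n * (b - a)) * r t) ρ := (hqi.const_mul _).add (hri.const_mul _)
    rw [e, integral_add hsum (integrable_const _),
      integral_add (hqi.const_mul _) (hri.const_mul _), integral_const_mul, integral_const_mul]
    simp only [integral_const, probReal_univ, one_smul, klAffine]
    ring
  have hexp : ∫ t, Real.exp (φ t) ∂π ≤ 2 * √n / δ := by
    have h1 : ∀ t, ENNReal.ofReal (Real.exp (φ t)) / ENNReal.ofReal (maxLikSum n) ≤
        sampleRatio D A B (t, S) := by
      intro t
      unfold sampleRatio likRatio
      have := ofReal_exp_klAffine_le hn (hk t) (hr01 t) ha hb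
      rw [hr_def] at this
      dsimp only at this
      rw [ofReal_measureReal] at this
      exact ENNReal.div_le_div_right this _
    have h2 : (∫⁻ t, ENNReal.ofReal (Real.exp (φ t)) ∂π) / ENNReal.ofReal (maxLikSum n) ≤
        (ENNReal.ofReal δ)⁻¹ := by
      rw [div_eq_mul_inv, ← lintegral_mul_const _ hφm.exp.ennreal_ofReal]
      exact (lintegral_mono h1).trans hS
    rw [ENNReal.div_le_iff (ENNReal.ofReal_pos.mpr (maxLikSum_pos n)).ne' ENNReal.ofReal_ne_top,
      ← ENNReal.ofReal_inv_of_pos hδ0, ← ENNReal.ofReal_mul (by positivity)] at h2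
    rw [integral_eq_lintegral_of_nonneg_ae (ae_of_all _ fun t => (Real.exp_pos _).le)
      hφm.exp.aestronglyMeasurable]
    refine (ENNReal.toReal_le_of_le_ofReal
      (mul_nonneg (by positivity) (maxLikSum_pos n).le) h2).trans ?_
    rw [inv_mul_eq_div]
    exact div_le_div_of_nonneg_right (maxLikSum_le n hn) hδ0.le
  have hpos : 0 < ∫ t, Real.exp (φ t) ∂π := by
    refine integral_exp_pos (.of_bound hφm.exp.aestronglyMeasurable
      (Real.exp (n * (|Real.log a| + |Real.log b| + 1 + a + b))) (ae_of_all _ fun t => ?_))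
    rw [Real.norm_eq_abs, Real.abs_exp, Real.exp_le_exp]
    exact (le_abs_self _).trans (hφb t)
  have hl := Real.log_le_log hpos hexp
  rw [le_div_iff₀ hn']
  rw [hφint] at hdv
  linarith

/-! ### From the Gibbs risk to the risk of a deterministic classifier. -/

section

variable {X Y Y' H : Type*} [MeasurableSpace X] [MeasurableSpace Y] [MeasurableSpace H]

lemma measurableSet_lossEvent {l : Y' → Y → ℝ} {h : X → Y'}
    (hh : Measurable fun z : X × Y => l (h z.1) z.2) (v : ℝ) : MeasurableSet (lossEvent l h v) :=
  hh (measurableSet_singleton v)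

lemma risk_eq_measureReal {l : Y' → Y → ℝ} (hl : ∀ y' y, l y' y = 0 ∨ l y' y = 1) {h : X → Y'}
    (hh : Measurable fun z : X × Y => l (h z.1) z.2) (P : Measure (X × Y)) :
    risk l P h = P.real (lossEvent l h 1) := by
  rw [risk, ← integral_indicator_one (measurableSet_lossEvent hh 1)]
  congr 1
  funext z
  rcases hl (h z.1) z.2 with hz | hz <;> simp [Set.indicator, lossEvent, hz]

lemma compl_lossEvent_one {X Y Y' : Type*} {l : Y' → Y → ℝ}
    (hl : ∀ y' y, l y' y = 0 ∨ l y' y = 1) (h : X → Y') :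
    (lossEvent l h 1)ᶜ = lossEvent l h 0 := by
  ext z
  rcases hl (h z.1) z.2 with hz | hz <;> simp [lossEvent, hz]

/-- On a null event both sides vanish, whatever value `condGibbs` takes there. -/
lemma setIntegral_eq_mul_condGibbs (l : Y' → Y → ℝ) (f : H → X → Y') (P : Measure (X × Y))
    [IsProbabilityMeasure P] (ρ : Measure H) (h : X → Y') (v : ℝ) :
    ∫ z in lossEvent l h v, (∫ t, l (f t z.1) z.2 ∂ρ) ∂P =
      P.real (lossEvent l h v) * condGibbs l f P ρ h v := by
  by_cases h0 : P (lossEvent l h v) = 0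
  · rw [Measure.restrict_eq_zero.mpr h0]
    simp [measureReal_def, h0]
  · rw [condGibbs, ProbabilityTheory.cond, integral_smul_measure, smul_eq_mul,
      ENNReal.toReal_inv, measureReal_def, mul_inv_cancel_left₀]
    exact ENNReal.toReal_ne_zero.mpr ⟨h0, measure_ne_top _ _⟩

lemma gibbsRisk_eq {l : Y' → Y → ℝ} (hl : ∀ y' y, l y' y = 0 ∨ l y' y = 1) {f : H → X → Y'}
    (hf : Measurable fun p : H × X × Y => l (f p.1 p.2.1) p.2.2) (P : Measure (X × Y))
    [IsProbabilityMeasure P] (ρ : Measure H) [IsProbabilityMeasure ρ] {h : X → Y'}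
    (hh : Measurable fun z : X × Y => l (h z.1) z.2) :
    gibbsRisk l f P ρ = P.real (lossEvent l h 0) * condGibbs l f P ρ h 0 +
      P.real (lossEvent l h 1) * condGibbs l f P ρ h 1 := by
  have hint : Integrable (Function.uncurry fun (t : H) (z : X × Y) => l (f t z.1) z.2)
      (ρ.prod P) := by
    refine .of_bound (Measurable.aestronglyMeasurable hf) 1 (ae_of_all _ fun p => ?_)
    rcases hl (f p.1 p.2.1) p.2.2 with hz | hz <;> simp [Function.uncurry, hz]
  have hint' : Integrable (fun z : X × Y => ∫ t, l (f t z.1) z.2 ∂ρ) P := hint.integral_prod_right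
  unfold gibbsRisk risk
  rw [integral_integral_swap hint, ← integral_add_compl (measurableSet_lossEvent hh 1) hint',
    compl_lossEvent_one hl, setIntegral_eq_mul_condGibbs, setIntegral_eq_mul_condGibbs, add_comm]

lemma measureReal_lossEvent_zero {l : Y' → Y → ℝ} (hl : ∀ y' y, l y' y = 0 ∨ l y' y = 1)
    (P : Measure (X × Y)) [IsProbabilityMeasure P] {h : X → Y'}
    (hh : Measurable fun z : X × Y => l (h z.1) z.2) :
    P.real (lossEvent l h 0) = 1 - risk l P h := by
  rw [← compl_lossEvent_one hl, probReal_compl_eq_one_sub (measurableSet_lossEvent hh 1),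
    risk_eq_measureReal hl hh]

/-- With `R = risk l P h`, one gets `(1 - R) b↓ + R c↓ ≤ u`; solving for `R` uses `b↓ < c↓`. A bound
missing on a null event has weight zero. -/
lemma risk_le_of_isLowerCondBound {l : Y' → Y → ℝ} (hl : ∀ y' y, l y' y = 0 ∨ l y' y = 1)
    {f : H → X → Y'} (hf : Measurable fun p : H × X × Y => l (f p.1 p.2.1) p.2.2)
    (P : Measure (X × Y)) [IsProbabilityMeasure P] (ρ : Measure H) [IsProbabilityMeasure ρ]
    {h : X → Y'} (hh : Measurable fun z : X × Y => l (h z.1) z.2) {β : CondBound}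
    (hβ : IsLowerCondBound l f P ρ h β) {u : ℝ} (hu : gibbsRisk l f P ρ ≤ u) :
    risk l P h ≤ (u - β.b) / (β.c - β.b) := by
  have key : ∀ v x : ℝ, (P (lossEvent l h v) ≠ 0 → x ≤ condGibbs l f P ρ h v) →
      P.real (lossEvent l h v) * x ≤ P.real (lossEvent l h v) * condGibbs l f P ρ h v := by
    intro v x hx
    by_cases h0 : P (lossEvent l h v) = 0
    · simp [measureReal_def, h0]
    · exact mul_le_mul_of_nonneg_left (hx h0) measureReal_nonneg
  have k0 := key 0 β.b hβ.b_le
  have k1 := key 1 β.c hβ.c_le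
  rw [gibbsRisk_eq hl hf P ρ hh] at hu
  rw [le_div_iff₀ (sub_pos.mpr hβ.b_lt_c)]
  rw [measureReal_lossEvent_zero hl P hh] at k0 hu
  rw [← risk_eq_measureReal hl hh] at k1 hu
  linarith

lemma le_risk_of_isUpperCondBound {l : Y' → Y → ℝ} (hl : ∀ y' y, l y' y = 0 ∨ l y' y = 1)
    {f : H → X → Y'} (hf : Measurable fun p : H × X × Y => l (f p.1 p.2.1) p.2.2)
    (P : Measure (X × Y)) [IsProbabilityMeasure P] (ρ : Measure H) [IsProbabilityMeasure ρ]
    {h : X → Y'} (hh : Measurable fun z : X × Y => l (h z.1) z.2) {β : CondBound}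
    (hβ : IsUpperCondBound l f P ρ h β) {u : ℝ} (hu : u ≤ gibbsRisk l f P ρ) :
    (u - β.b) / (β.c - β.b) ≤ risk l P h := by
  have key : ∀ v x : ℝ, (P (lossEvent l h v) ≠ 0 → condGibbs l f P ρ h v ≤ x) →
      P.real (lossEvent l h v) * condGibbs l f P ρ h v ≤ P.real (lossEvent l h v) * x := by
    intro v x hx
    by_cases h0 : P (lossEvent l h v) = 0
    · simp [measureReal_def, h0]
    · exact mul_le_mul_of_nonneg_left (hx h0) measureReal_nonneg
  have k0 := key 0 β.b hβ.le_b
  have k1 := key 1 β.c hβ.le_c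
  rw [gibbsRisk_eq hl hf P ρ hh] at hu
  rw [div_le_iff₀ (sub_pos.mpr hβ.b_lt_c)]
  rw [measureReal_lossEvent_zero hl P hh] at k0 hu
  rw [← risk_eq_measureReal hl hh] at k1 hu
  linarith

lemma gibbsRisk_mem_Icc {l : Y' → Y → ℝ} (hl : ∀ y' y, l y' y = 0 ∨ l y' y = 1) {f : H → X → Y'}
    (hf : Measurable fun p : H × X × Y => l (f p.1 p.2.1) p.2.2) (P : Measure (X × Y))
    [IsProbabilityMeasure P] (ρ : Measure H) [IsProbabilityMeasure ρ] :
    gibbsRisk l f P ρ ∈ Set.Icc (0 : ℝ) 1 := by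
  have h01 : ∀ t, risk l P (f t) ∈ Set.Icc (0 : ℝ) 1 := fun t => by
    rw [risk_eq_measureReal hl (hf.comp measurable_prodMk_left)]
    exact ⟨measureReal_nonneg, measureReal_le_one⟩
  refine ⟨integral_nonneg fun t => (h01 t).1, ?_⟩
  calc _ ≤ ∫ _ : H, (1 : ℝ) ∂ρ :=
        integral_mono_of_nonneg (ae_of_all _ fun t => (h01 t).1) (integrable_const _)
          (ae_of_all _ fun t => (h01 t).2)
    _ = 1 := by simp

/-! ### Risks and empirical risks as measures and counts of error sets. -/

lemma measurable_dropAttribute : Measurable fun z : X × Bool × Y => (z.1, z.2.2) :=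
  measurable_fst.prodMk (measurable_snd.comp measurable_snd)

/-- The pairs of a hypothesis and an example on which the hypothesis errs. -/
def errorSet (l : Y' → Y → ℝ) (f : H → X → Y') : Set (H × X × Bool × Y) :=
  {p | l (f p.1 p.2.1) p.2.2.2 = 1}

lemma measurableSet_errorSet {l : Y' → Y → ℝ} {f : H → X → Y'}
    (hf : Measurable fun p : H × X × Y => l (f p.1 p.2.1) p.2.2) :
    MeasurableSet (errorSet l f) :=
  (hf.comp (measurable_fst.prodMk (measurable_dropAttribute.comp measurable_snd)))
    (measurableSet_singleton 1)

lemma risk_xyMarginal {l : Y' → Y → ℝ} (hl : ∀ y' y, l y' y = 0 ∨ l y' y = 1) {f : H → X → Y'}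
    (hf : Measurable fun p : H × X × Y => l (f p.1 p.2.1) p.2.2) (D : Measure (X × Bool × Y))
    (t : H) : risk l (xyMarginal D) (f t) = D.real (Prod.mk t ⁻¹' errorSet l f) := by
  have hm : Measurable fun z : X × Y => l (f t z.1) z.2 := hf.comp measurable_prodMk_left
  rw [risk_eq_measureReal hl hm, xyMarginal,
    map_measureReal_apply measurable_dropAttribute (measurableSet_lossEvent hm 1)]
  rfl

lemma empRisk_hitIdx {X Y Y' H : Type*} {l : Y' → Y → ℝ}
    (hl : ∀ y' y, l y' y = 0 ∨ l y' y = 1) (f : H → X → Y')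
    {m : ℕ} (S : Fin m → X × Bool × Y) (A : Set (X × Bool × Y)) (t : H) :
    empRisk l S (hitIdx A S) (f t) =
      ((hitIdx (A ∩ Prod.mk t ⁻¹' errorSet l f) S).card : ℝ) / (hitIdx A S).card := by
  classical
  have h1 : hitIdx (A ∩ Prod.mk t ⁻¹' errorSet l f) S =
      (hitIdx A S).filter fun i => l (f t (S i).1) (S i).2.2 = 1 := by
    ext i
    rw [Finset.mem_filter, mem_hitIdx, mem_hitIdx]
    rfl
  rw [empRisk, one_div_mul_eq_div, h1, Finset.card_filter, Nat.cast_sum]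
  congr 1
  refine Finset.sum_congr rfl fun i _ => ?_
  rcases hl (f t (S i).1) (S i).2.2 with hz | hz <;> simp [hz]

/-- The PAC-Bayesian bounds on the Gibbs risk of the part `A` of the distribution. -/
lemma gibbsRisk_le_gibbsUp_and_gibbsLow_le {l : Y' → Y → ℝ}
    (hl : ∀ y' y, l y' y = 0 ∨ l y' y = 1) {f : H → X → Y'}
    (hf : Measurable fun p : H × X × Y => l (f p.1 p.2.1) p.2.2) {m : ℕ}
    (D : Measure (X × Bool × Y)) [IsProbabilityMeasure D] {A : Set (X × Bool × Y)}
    (hA : MeasurableSet A) (hDA : D A ≠ 0) (π : Measure H) [IsProbabilityMeasure π]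
    {δ : ℝ} (hδ0 : 0 < δ) (hδ1 : δ ≤ 1) (S : Fin m → X × Bool × Y)
    (hS : ∫⁻ t, sampleRatio D A (errorSet l f) (t, S) ∂π ≤ (ENNReal.ofReal δ)⁻¹)
    (ρ : Measure H) [IsProbabilityMeasure ρ] :
    gibbsRisk l f (xyMarginal (cond D A)) ρ ≤ gibbsUp l f S (hitIdx A S) ρ π δ ∧
      gibbsLow l f S (hitIdx A S) ρ π δ ≤ gibbsRisk l f (xyMarginal (cond D A)) ρ := by
  have := cond_isProbabilityMeasure hDA
  have : IsProbabilityMeasure (xyMarginal (cond D A)) :=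
    Measure.isProbabilityMeasure_map measurable_dropAttribute.aemeasurable
  have h := binKL_integral_le_klRadius D hA hDA (measurableSet_errorSet hf) π hδ0 hδ1 S hS ρ
  simp_rw [← empRisk_hitIdx hl, ← risk_xyMarginal hl hf] at h
  -- The `kl` inequality is two-sided: this one membership yields both the supremum and the infimum
  -- bound.
  have hmem : gibbsRisk l f (xyMarginal (cond D A)) ρ ∈ {r : ℝ | r ∈ Set.Icc (0 : ℝ) 1 ∧
      binKL (empGibbsRisk l f S (hitIdx A S) ρ) r ≤
        klRadius (hitIdx A S).card (InformationTheory.klDiv ρ π) δ} :=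
    ⟨gibbsRisk_mem_Icc hl hf _ ρ, h⟩
  exact ⟨le_csSup ⟨1, fun r hr => hr.1.2⟩ hmem, csInf_le ⟨0, fun r hr => hr.1.1⟩ hmem⟩

lemma groupIdx_eq_hitIdx {X Y : Type*} {m : ℕ} (S : Fin m → X × Bool × Y) (g : Bool) :
    groupIdx S g = hitIdx {z | z.2.1 = g} S := by
  ext i
  simp [groupIdx, mem_hitIdx]

lemma univ_eq_hitIdx {Z : Type*} {m : ℕ} (S : Fin m → Z) :
    Finset.univ = hitIdx Set.univ S := by
  ext i
  simp [mem_hitIdx]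

end

end PACFair

/-! ### The union bound and the final assembly. -/

open PACFair in
theorem mainTheorem5
    {X Y Y' H : Type*} [MeasurableSpace X] [MeasurableSpace Y] [MeasurableSpace H]
    -- the distribution of (input, sensitive attribute, label); both groups have positive mass
    (D : MeasureTheory.Measure (X × Bool × Y)) [MeasureTheory.IsProbabilityMeasure D]
    (hD : ∀ g : Bool, D {z | z.2.1 = g} ≠ 0)
    -- the binary loss and the hypotheses
    (l : Y' → Y → ℝ) (hl : ∀ y' y, l y' y = 0 ∨ l y' y = 1)
    (f : H → X → Y')
    (hf : Measurable fun p : H × X × Y => l (f p.1 p.2.1) p.2.2)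
    -- the prior, the confidence, the trade-off parameter and the sample size
    (π : MeasureTheory.Measure H) [MeasureTheory.IsProbabilityMeasure π]
    (δ : ℝ) (hδ0 : 0 < δ) (hδ1 : δ ≤ 1)
    (lam : ℝ) (hlam0 : 0 ≤ lam) (hlam1 : lam ≤ 1)
    (m : ℕ) :
    ∃ E : Set (Fin m → X × Bool × Y),
      MeasurableSet E ∧
      ENNReal.ofReal (1 - δ) ≤ MeasureTheory.Measure.pi (fun _ : Fin m => D) E ∧
      ∀ S ∈ E,
        ∀ (ρ : MeasureTheory.Measure H), MeasureTheory.IsProbabilityMeasure ρ →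
        -- every classifier, in particular each `f t` and the majority vote of `ρ`
        ∀ (h : X → Y'), (Measurable fun z : X × Y => l (h z.1) z.2) →
        ∀ lo loA upA loB upB : CondBound,
          IsLowerCondBound l f (xyMarginal D) ρ h lo →
          IsLowerCondBound l f (groupCond D true) ρ h loA →
          IsUpperCondBound l f (groupCond D true) ρ h upA →
          IsLowerCondBound l f (groupCond D false) ρ h loB →
          IsUpperCondBound l f (groupCond D false) ρ h upB →
          (1 - lam) * risk l (xyMarginal D) h + lam * fairRisk l D h
            ≤ objectiveH l f S ρ π δ lam lo loA upA loB upB := by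
  let bad : Set (X × Bool × Y) → ℝ → Set (Fin m → X × Bool × Y) := fun A δ' =>
    {S | (ENNReal.ofReal δ')⁻¹ ≤ ∫⁻ t, sampleRatio D A (errorSet l f) (t, S) ∂π}
  let G : Bool → Set (X × Bool × Y) := fun g => {z | z.2.1 = g}
  have hG : ∀ g, MeasurableSet (G g) := fun g =>
    (measurable_fst.comp measurable_snd) (measurableSet_singleton g)
  have hB := measurableSet_errorSet hf
  have hbad : ∀ A δ', MeasurableSet A → MeasurableSet (bad A δ') := fun A δ' hA =>
    measurableSet_le measurable_const (measurable_sampleRatio D hA hB).lintegral_prod_left'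
  have hU : D Set.univ ≠ 0 := by simp
  -- One event per group serves its upper and lower bounds, so the total failure probability is at
  -- most `δ/2 + δ/8 + δ/8 = 3δ/4`.
  let F := bad Set.univ (δ / 2) ∪ (bad (G true) (δ / 8) ∪ bad (G false) (δ / 8))
  have hF : MeasurableSet F :=
    (hbad _ _ .univ).union ((hbad _ _ (hG true)).union (hbad _ _ (hG false)))
  have hFle : Measure.pi (fun _ : Fin m => D) F ≤ ENNReal.ofReal δ := by
    have h1 := measure_lintegral_sampleRatio_ge_le (m := m) D .univ hU hB π (δ / 2) (by positivity)
    have h2 := fun g => measure_lintegral_sampleRatio_ge_le (m := m) D (hG g) (hD g) hB π (δ / 8)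
      (by positivity)
    calc _ ≤ ENNReal.ofReal (δ / 2) + (ENNReal.ofReal (δ / 8) + ENNReal.ofReal (δ / 8)) :=
          (measure_union_le _ _).trans (add_le_add h1 ((measure_union_le _ _).trans
            (add_le_add (h2 true) (h2 false))))
      _ = ENNReal.ofReal (δ / 2 + (δ / 8 + δ / 8)) := by
          rw [ENNReal.ofReal_add, ENNReal.ofReal_add] <;> positivity
      _ ≤ _ := ENNReal.ofReal_le_ofReal (by linarith)
  refine ⟨Fᶜ, hF.compl, ?_, ?_⟩
  · rw [prob_compl_eq_one_sub hF, ENNReal.ofReal_sub _ hδ0.le, ENNReal.ofReal_one]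
    exact tsub_le_tsub_left hFle 1
  intro S hS ρ hρ h hh lo loA upA loB upB hlo hloA hupA hloB hupB
  have hSU : S ∉ bad Set.univ (δ / 2) := fun h => hS (Or.inl h)
  have hSG : ∀ g, S ∉ bad (G g) (δ / 8) := by
    rintro (_ | _) h
    exacts [hS (Or.inr (Or.inr h)), hS (Or.inr (Or.inl h))]
  have bU := (gibbsRisk_le_gibbsUp_and_gibbsLow_le hl hf D .univ hU π (δ := δ / 2)
    (by positivity) (by linarith) S (not_le.mp hSU).le ρ).1
  rw [cond_univ, ← univ_eq_hitIdx] at bU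
  have bG := fun g => gibbsRisk_le_gibbsUp_and_gibbsLow_le hl hf D (hG g) (hD g) π (δ := δ / 8)
    (by positivity) (by linarith) S (not_le.mp (hSG g)).le ρ
  have bG' : ∀ g, gibbsRisk l f (groupCond D g) ρ ≤ gibbsUp l f S (groupIdx S g) ρ π (δ / 8) ∧
      gibbsLow l f S (groupIdx S g) ρ π (δ / 8) ≤ gibbsRisk l f (groupCond D g) ρ := by
    intro g
    rw [groupIdx_eq_hitIdx]
    exact bG g
  have : IsProbabilityMeasure (xyMarginal D) :=
    Measure.isProbabilityMeasure_map measurable_dropAttribute.aemeasurable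
  have : ∀ g, IsProbabilityMeasure (groupCond D g) := fun g => by
    have := cond_isProbabilityMeasure (hD g)
    exact Measure.isProbabilityMeasure_map measurable_dropAttribute.aemeasurable
  have r := risk_le_of_isLowerCondBound hl hf _ ρ hh hlo bU
  have rA := risk_le_of_isLowerCondBound hl hf _ ρ hh hloA (bG' true).1
  have rB := risk_le_of_isLowerCondBound hl hf _ ρ hh hloB (bG' false).1
  have sA := le_risk_of_isUpperCondBound hl hf _ ρ hh hupA (bG' true).2
  have sB := le_risk_of_isUpperCondBound hl hf _ ρ hh hupB (bG' false).2
  unfold objectiveH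
  refine add_le_add (mul_le_mul_of_nonneg_left r (by linarith))
    (mul_le_mul_of_nonneg_left ?_ hlam0)
  unfold fairRisk fairBound
  refine abs_le'.mpr ⟨le_max_of_le_left (sub_le_sub rA sB), le_max_of_le_right ?_⟩
  rw [neg_sub]
  exact sub_le_sub rB sA
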